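/- **Setting.** Let $K$ be a field whose characteristic does not divide $6$ (characteristic $0$ is allowed), with algebraic closure $\overline K$. Let $f\in K[z]$ be a cubic polynomial, write $f^n$ for its $n$-th iterate, and let $\ell\ge 2$. Suppose that $\gamma_1,\gamma_2\in\overline K$ are critical points of $f$ that collide at the $\ell$-th iterate, that is, $f^{\ell}(\gamma_1)=f^{\ell}(\gamma_2)$ but $f^{\ell-1}(\gamma_1)\ne f^{\ell-1}(\gamma_2)$. For $x_0\in K$ let $K_n=K(f^{-n}(x_0))\subseteq\overline K$, $K_\infty=\bigcup_{n\ge0}K_n$ and $G_{K,\infty}=\mathrm{Gal}(K_\infty/K)$. If $x_0\ne f^n(\gamma_i)$ for all $n\ge1$ and $i=1,2$, then the backward orbit $\coprod_{n\ge 0}f^{-n}(x_0)$, with root $x_0$ and with each $y\in f^{-(n+1)}(x_0)$ joined to $f(y)\in f^{-n}(x_0)$, is an infinite ternary rooted tree, on which $G_{K,\infty}$ acts. A labeling of this tree is a bijection from its nodes to the finite words in $\{0,1,2\}$ such that whenever a node above the root has label $s_1\cdots s_m$, the node immediately below it has label $s_1\cdots s_{m-1}$ (so the root has the empty label). Let $\mathrm{Aut}(T_{3,\infty})$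 be the group of automorphisms of the rooted tree of all such words. For $\sigma\in\mathrm{Aut}(T_{3,\infty})$, a node $y$ and $m\ge1$, let $\mathrm{sgn}_m(\sigma,y)\in\{\pm1\}$ be the sign of the permutation $(s_1,\dots,s_m)\mapsto(t_1,\dots,t_m)$ of $\{0,1,2\}^m$ defined by $\sigma(y s_1\cdots s_m)=\sigma(y)t_1\cdots t_m$. Let $\widetilde Q_{\ell,\infty}$ be the subgroup of all $\sigma\in\mathrm{Aut}(T_{3,\infty})$ such that $$\mathrm{sgn}_\ell(\sigma,y)\,\mathrm{sgn}_{\ell-1}(\sigma,y)=\mathrm{sgn}_\ell(\sigma,())\,\mathrm{sgn}_{\ell-1}(\sigma,())\quad\text{for every node } y,$$ where $()$ is the root, and let $Q_{\ell,\infty}$ be the subgroup of those $\sigma\in\widetilde Q_{\ell,\infty}$ for which this common value is $+1$. For a subgroup $H$ of $\mathrm{Aut}(T_{3,\infty})$, say that $G_{K,\infty}$ is *isomorphic to a subgroup of $H$ via an appropriate labeling* if there are a labeling of the tree of preimages of $x_0$ and an injective homomorphism $G_{K,\infty}\to\mathrm{Aut}(T_{3,\infty})$ with image contained in $H$ that is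 equivariant with respect to the actions on the tree, the nodes being identified with words by that labeling. **Theorem.** The common value $f^{\ell}(\gamma_1)=f^{\ell}(\gamma_2)$ lies in $K$. Furthermore, let $x_0\in K$ be such that $x_0\neq f^n(\gamma_i)$ for all $n\ge1$ and $i=1,2$. Then: 1. $G_{K,\infty}$ is isomorphic to a subgroup of $\widetilde Q_{\ell,\infty}$ via an appropriate labeling. 2. $G_{K,\infty}$ is isomorphic to a subgroup of $Q_{\ell,\infty}$ via an appropriate labeling if and only if $-3$ is a square in $K$. -/

import Mathlib

namespace Arboreal

section Tree

/-- The group of automorphisms of the infinite ternary rooted tree. The nodes at level `m`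
are the words `s₁ s₂ … sₘ` in the symbols `0, 1, 2`, the root is the empty word, and the node
immediately below `s₁ … sₘ` is `s₁ … sₘ₋₁`, that is `List.dropLast` (the root is sent to itself).
An automorphism is a permutation of the nodes that commutes with this parent map. -/
def TreeAut : Subgroup (Equiv.Perm (List (Fin 3))) where
  carrier := {σ | ∀ w : List (Fin 3), σ w.dropLast = (σ w).dropLast}
  mul_mem' := by
    intro σ τ hσ hτ w
    simp only [Set.mem_ofPred_eq] at hσ hτ
    simp [Equiv.Perm.mul_apply, hσ, hτ]
  one_mem' := by intro w; rfl
  inv_mem' := by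
    intro σ hσ w
    simp only [Set.mem_ofPred_eq] at hσ
    apply σ.injective
    rw [hσ]
    simp

theorem treeAut_dropLast (σ : TreeAut) (w : List (Fin 3)) :
    σ.1 w.dropLast = (σ.1 w).dropLast := σ.2 w

theorem treeAut_nil (σ : TreeAut) : σ.1 [] = [] := by
  have h := congrArg List.length (treeAut_dropLast σ [])
  simp only [List.dropLast_nil, List.length_dropLast] at h
  exact List.length_eq_zero_iff.mp (by omega)

theorem treeAut_prefix_append (σ : TreeAut) (y s : List (Fin 3)) :
    σ.1 y <+: σ.1 (y ++ s) := by
  induction s using List.reverseRecOn with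
  | nil => simp
  | append_singleton s a ih =>
    have h := treeAut_dropLast σ (y ++ (s ++ [a]))
    rw [← List.append_assoc, List.dropLast_concat] at h
    rw [h] at ih
    rw [← List.append_assoc]
    exact ih.trans (List.dropLast_prefix _)

theorem treeAut_length (σ : TreeAut) (w : List (Fin 3)) : (σ.1 w).length = w.length := by
  induction w using List.reverseRecOn with
  | nil => simp [treeAut_nil σ]
  | append_singleton w a ih =>
    have h := congrArg List.length (treeAut_dropLast σ (w ++ [a]))
    rw [List.dropLast_concat, ih, List.length_dropLast] at h
    have h0 : σ.1 (w ++ [a]) ≠ [] := by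
      intro h1
      rw [← treeAut_nil σ] at h1
      simpa using σ.1.injective h1
    have := List.length_pos_iff.mpr h0
    simp only [List.length_append, List.length_cons, List.length_nil]
    omega

theorem treeAut_append_drop (σ : TreeAut) (y s : List (Fin 3)) :
    σ.1 y ++ (σ.1 (y ++ s)).drop y.length = σ.1 (y ++ s) := by
  obtain ⟨t, ht⟩ := treeAut_prefix_append σ y s
  rw [← ht, ← treeAut_length σ y, List.drop_left]

/-- The permutation of `{0,1,2}^m` induced by a tree automorphism `σ` above the node `y`:
it sends `(s₁, …, sₘ)` to the `(t₁, …, tₘ)` with `σ (y s₁ … sₘ) = σ(y) t₁ … tₘ`. -/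
def permAbove (m : ℕ) (σ : TreeAut) (y : List (Fin 3)) :
    Equiv.Perm (List.Vector (Fin 3) m) where
  toFun s := ⟨(σ.1 (y ++ s.1)).drop y.length, by
    rw [List.length_drop, treeAut_length σ, List.length_append, s.2]; omega⟩
  invFun t := ⟨((σ⁻¹).1 (σ.1 y ++ t.1)).drop y.length, by
    rw [List.length_drop, treeAut_length (σ⁻¹), List.length_append, treeAut_length σ, t.2]; omega⟩
  left_inv s := by
    apply Subtype.ext
    change ((σ⁻¹).1 (σ.1 y ++ (σ.1 (y ++ s.1)).drop y.length)).drop y.length = s.1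
    rw [treeAut_append_drop σ]
    simp
  right_inv t := by
    apply Subtype.ext
    have h := treeAut_append_drop (σ⁻¹) (σ.1 y) t.1
    have hy : (σ⁻¹).1 (σ.1 y) = y := by simp
    rw [hy, treeAut_length σ] at h
    change (σ.1 (y ++ ((σ⁻¹).1 (σ.1 y ++ t.1)).drop y.length)).drop y.length = t.1
    rw [h, ← treeAut_length σ y]
    simp

theorem permAbove_spec (m : ℕ) (σ : TreeAut) (y : List (Fin 3)) (s : List.Vector (Fin 3) m) :
    σ.1 (y ++ s.1) = σ.1 y ++ (permAbove m σ y s).1 :=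
  (treeAut_append_drop σ y s.1).symm

/-- The `m`-th sign of `σ` above the node `y`. -/
def sgn (m : ℕ) (σ : TreeAut) (y : List (Fin 3)) : ℤˣ :=
  Equiv.Perm.sign (permAbove m σ y)

theorem sgn_mul (m : ℕ) (σ τ : TreeAut) (y : List (Fin 3)) :
    sgn m (σ * τ) y = sgn m σ (τ.1 y) * sgn m τ y := by
  unfold sgn
  rw [← Equiv.Perm.sign_mul]
  congr 1
  refine Equiv.ext fun s => Subtype.ext ?_
  apply List.append_cancel_left (as := (σ * τ).1 y)
  rw [← permAbove_spec]
  change σ.1 (τ.1 (y ++ s.1)) =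
    σ.1 (τ.1 y) ++ (permAbove m σ (τ.1 y) (permAbove m τ y s)).1
  rw [permAbove_spec m τ y s, permAbove_spec]

theorem sgn_one (m : ℕ) (y : List (Fin 3)) : sgn m 1 y = 1 := by
  have h := sgn_mul m 1 1 y
  simpa using h

theorem sgn_inv (m : ℕ) (σ : TreeAut) (y : List (Fin 3)) :
    sgn m σ⁻¹ y = (sgn m σ ((σ⁻¹).1 y))⁻¹ := by
  have h := sgn_mul m σ σ⁻¹ y
  rw [mul_inv_cancel, sgn_one] at h
  exact (inv_eq_of_mul_eq_one_right h.symm).symm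

/-- The group `Q̃_{ℓ,∞}`: all `σ` such that the product `sgn_ℓ(σ,y) sgn_{ℓ-1}(σ,y)` has at every
node `y` the same value as at the root. -/
def Qtilde (ℓ : ℕ) : Subgroup TreeAut where
  carrier := {σ | ∀ y : List (Fin 3),
    sgn ℓ σ y * sgn (ℓ - 1) σ y = sgn ℓ σ [] * sgn (ℓ - 1) σ []}
  mul_mem' := by
    intro σ τ hσ hτ y
    rw [sgn_mul, sgn_mul, sgn_mul, sgn_mul, mul_mul_mul_comm, hσ, hτ, mul_mul_mul_comm,
      mul_mul_mul_comm (sgn ℓ σ (τ.1 [])), hσ (τ.1 []), mul_mul_mul_comm]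
  one_mem' := by intro y; simp [sgn_one]
  inv_mem' := by
    intro σ hσ y
    rw [sgn_inv, sgn_inv, sgn_inv, sgn_inv, ← mul_inv, ← mul_inv, hσ, hσ ((σ⁻¹).1 [])]

/-- The group `Q_{ℓ,∞}`: all `σ` in `Q̃_{ℓ,∞}` for which the common product is `+1`. -/
def Q (ℓ : ℕ) : Subgroup TreeAut where
  carrier := {σ | σ ∈ Qtilde ℓ ∧ sgn ℓ σ [] * sgn (ℓ - 1) σ [] = 1}
  mul_mem' := by
    rintro σ τ ⟨hσ, hσ'⟩ ⟨hτ, hτ'⟩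
    refine ⟨mul_mem hσ hτ, ?_⟩
    rw [sgn_mul, sgn_mul, mul_mul_mul_comm, treeAut_nil τ, hσ', hτ', one_mul]
  one_mem' := ⟨one_mem _, by simp [sgn_one]⟩
  inv_mem' := by
    rintro σ ⟨hσ, hσ'⟩
    refine ⟨inv_mem hσ, ?_⟩
    rw [sgn_inv, sgn_inv, ← mul_inv, treeAut_nil (σ⁻¹), hσ', inv_one]

end Tree

section Dynamics

open Polynomial

variable {K : Type*} [Field K]

/-- A polynomial `f` over `K` as a self-map `z ↦ f(z)` of a `K`-algebra; its iterates
`(polyMap f)^[n]` are the maps `z ↦ fⁿ(z)`. -/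
noncomputable def polyMap {R : Type*} [CommRing R] [Algebra K R] (f : K[X]) (z : R) : R :=
  aeval z f

theorem polyMap_iterate_algHom {R S : Type*} [CommRing R] [CommRing S] [Algebra K R] [Algebra K S]
    (f : K[X]) (φ : R →ₐ[K] S) (n : ℕ) (z : R) :
    φ ((polyMap f)^[n] z) = (polyMap f)^[n] (φ z) :=
  Function.Semiconj.iterate_right (f := φ) (ga := polyMap f) (gb := polyMap f)
    (fun x => (aeval_algHom_apply φ x f).symm) n z

/-- `γ₁` and `γ₂` are critical points of the polynomial `f` that collide at the `ℓ`-th iterate,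
`ℓ ≥ 1`. -/
def CollideAt {R : Type*} [CommRing R] [Algebra K R] (f : K[X]) (γ₁ γ₂ : R) (ℓ : ℕ) : Prop :=
  1 ≤ ℓ ∧ aeval γ₁ (derivative f) = 0 ∧ aeval γ₂ (derivative f) = 0 ∧
    (polyMap f)^[ℓ] γ₁ = (polyMap f)^[ℓ] γ₂ ∧
    (polyMap f)^[ℓ - 1] γ₁ ≠ (polyMap f)^[ℓ - 1] γ₂

variable (Kbar : Type*) [Field Kbar] [Algebra K Kbar]

/-- The field `Kₙ = K(f⁻ⁿ(x₀))`. -/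
noncomputable def levelField (f : K[X]) (x₀ : K) (n : ℕ) : IntermediateField K Kbar :=
  IntermediateField.adjoin K {y : Kbar | (polyMap f)^[n] y = algebraMap K Kbar x₀}

/-- The field `K_∞`, generated by all the `Kₙ` (which form an increasing sequence when `f` is not
constant, so that `K_∞` is then their union). -/
noncomputable def arborealField (f : K[X]) (x₀ : K) : IntermediateField K Kbar :=
  ⨆ n : ℕ, levelField Kbar f x₀ n

/-- The arboreal Galois group `G_{K,∞} = Gal(K_∞/K)`. -/
abbrev ArborealGroup (f : K[X]) (x₀ : K) : Type _ :=
  arborealField Kbar f x₀ ≃ₐ[K] arborealField Kbar f x₀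

/-- The nodes of the tree of preimages of `x₀`: the backward orbit `∐ₙ f⁻ⁿ(x₀)`. The nodes at
level `n` are the solutions `y` of `fⁿ(y) = x₀`. -/
def BackwardOrbit (f : K[X]) (x₀ : K) : Type _ :=
  Σ n : ℕ, {y : Kbar // (polyMap f)^[n] y = algebraMap K Kbar x₀}

variable {Kbar}

/-- The node immediately below `y ∈ f⁻ⁿ⁻¹(x₀)` is `f(y) ∈ f⁻ⁿ(x₀)`; the root is sent to itself. -/
noncomputable def BackwardOrbit.parent {f : K[X]} {x₀ : K} :
    BackwardOrbit Kbar f x₀ → BackwardOrbit Kbar f x₀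
  | ⟨0, y⟩ => ⟨0, y⟩
  | ⟨n + 1, y⟩ => ⟨n, ⟨polyMap f y.1, y.2⟩⟩

theorem BackwardOrbit.mem_arborealField {f : K[X]} {x₀ : K} (v : BackwardOrbit Kbar f x₀) :
    v.2.1 ∈ arborealField Kbar f x₀ :=
  (le_iSup (fun n => levelField Kbar f x₀ n) v.1)
    (IntermediateField.subset_adjoin K _ v.2.2)

/-- The action of the arboreal Galois group on the nodes of the tree: `σ` sends `y ∈ f⁻ⁿ(x₀)` to
`σ(y) ∈ f⁻ⁿ(x₀)`. -/
noncomputable instance BackwardOrbit.mulAction (f : K[X]) (x₀ : K) :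
    MulAction (ArborealGroup Kbar f x₀) (BackwardOrbit Kbar f x₀) where
  smul σ v := ⟨v.1, ⟨((σ ⟨v.2.1, v.mem_arborealField⟩ : arborealField Kbar f x₀) : Kbar), by
    have h := polyMap_iterate_algHom f
      ((arborealField Kbar f x₀).val.comp σ.toAlgHom) v.1 ⟨v.2.1, v.mem_arborealField⟩
    have h' := polyMap_iterate_algHom f
      (arborealField Kbar f x₀).val v.1 ⟨v.2.1, v.mem_arborealField⟩
    have h'' : (polyMap f)^[v.1] (⟨v.2.1, v.mem_arborealField⟩ : arborealField Kbar f x₀) =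
        algebraMap K _ x₀ := Subtype.ext (h'.trans v.2.2)
    rw [h'', AlgHom.commutes] at h
    exact h.symm⟩⟩
  one_smul _ := rfl
  mul_smul _ _ _ := rfl

/-- A labeling of the tree of preimages: a bijection of its nodes with the words in `0, 1, 2`
such that the node immediately below a node with label `s₁ … sₘ` has label `s₁ … sₘ₋₁`. (The root
therefore has the empty label, and the nodes at level `m` have the labels of length `m`.) -/
structure Labeling (f : K[X]) (x₀ : K) (Kbar : Type*) [Field Kbar] [Algebra K Kbar] where
  label : BackwardOrbit Kbar f x₀ ≃ List (Fin 3)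
  label_parent : ∀ v : BackwardOrbit Kbar f x₀, label v.parent = (label v).dropLast

/-- The arboreal Galois group is isomorphic to a subgroup of `H`, via an appropriate labeling of
the tree: for some labeling there is an injective homomorphism from `G_{K,∞}` to the tree
automorphisms, with image contained in `H`, that is equivariant for the actions on the tree. -/
def EmbedsIn (Kbar : Type*) [Field Kbar] [Algebra K Kbar] (f : K[X]) (x₀ : K)
    (H : Subgroup TreeAut) : Prop :=
  ∃ (L : Labeling f x₀ Kbar) (φ : ArborealGroup Kbar f x₀ →* TreeAut),
    Function.Injective φ ∧ φ.range ≤ H ∧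
    ∀ (σ : ArborealGroup Kbar f x₀) (v : BackwardOrbit Kbar f x₀),
      (φ σ).1 (L.label v) = L.label (σ • v)

end Dynamics

end Arboreal

/-! Let a be the leading coefficient of f, m = ℓ - 1 and c = f^ℓ(γ₁) = f^ℓ(γ₂). The fiber over z has
discriminant, up to powers of a, equal to -27 (f(γ₁) - z)(f(γ₂) - z) (`IsFiber.sq_vdet`). Multiply
this over all z in f^{-m}(y). Each critical point contributes f^ℓ(γᵢ) - y = c - y up to a constant,
so the collision makes the product -3 times a square: the product Δ(y) of the Vandermonde
determinants of these fibers satisfies Δ(y)² = -3 (k (c - y))² with k in K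
(`Branching.sq_levelDet`).

On the Galois side, σ(Δ(y)) = sgn_ℓ(σ,y) sgn_{ℓ-1}(σ,y) Δ(σ(y)), because this product of signs is
the product of the signs of the fiber permutations m levels above y (`sgn_succ_mul_sgn`,
`Labeling.apply_levelDet`). If the fibers are ordered so that Δ(y) = s k (c - y) with a single s =
√-3 for all y (`exists_oriented_branching`), the sign product is σ(s)/s at every node, which gives
1. It is always +1 if s lies in K. Conversely, if it is +1 in some labeling, then Δ(x₀) is fixed by
the Galois group of a normal extension, so its square, which is -3 times a nonzero square of K, is a
square in K.

The value c lies in K because f^ℓ modulo f' is linear and takes the same value at two distinct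
points, hence is constant. -/

namespace Arboreal

/-! ### Signs of tree automorphisms and of their fiber permutations. -/

section Sign

/-- Words of length `m + 1` as pairs of a word of length `m` and a last symbol. -/
def vectorSnocEquiv (m : ℕ) :
    List.Vector (Fin 3) m × Fin 3 ≃ List.Vector (Fin 3) (m + 1) where
  toFun p := ⟨p.1.1 ++ [p.2], by simp [p.1.2]⟩
  invFun v := (⟨v.1.dropLast, by simp [v.2]⟩,
    v.1.getLast (List.ne_nil_of_length_pos (by simp [v.2])))
  left_inv p := by
    obtain ⟨⟨w, hw⟩, i⟩ := p
    simp
  right_inv v := Subtype.ext (List.dropLast_append_getLast _)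

/-- Symbols as words of length one. -/
def vectorOneEquiv : Fin 3 ≃ List.Vector (Fin 3) 1 where
  toFun i := ⟨[i], rfl⟩
  invFun v := v.head
  left_inv _ := rfl
  right_inv v := by
    obtain ⟨w, hw⟩ := v
    obtain ⟨i, rfl⟩ := List.length_eq_one_iff.mp hw
    rfl

/-- The permutation of the three children of `y` induced by `σ`. -/
def childPerm (σ : TreeAut) (y : List (Fin 3)) : Equiv.Perm (Fin 3) :=
  (vectorOneEquiv.trans (permAbove 1 σ y)).trans vectorOneEquiv.symm

theorem childPerm_spec (σ : TreeAut) (y : List (Fin 3)) (i : Fin 3) :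
    σ.1 (y ++ [i]) = σ.1 y ++ [childPerm σ y i] := by
  have h := permAbove_spec 1 σ y (vectorOneEquiv i)
  have h' : vectorOneEquiv (childPerm σ y i) = permAbove 1 σ y (vectorOneEquiv i) := by
    simp [childPerm]
  rw [← h'] at h
  exact h

theorem prod_vector_succ {M : Type*} [CommMonoid M] (m : ℕ) (g : List (Fin 3) → M) :
    ∏ w : List.Vector (Fin 3) (m + 1), g w.1 =
      ∏ w : List.Vector (Fin 3) m, ∏ i : Fin 3, g (w.1 ++ [i]) := by
  rw [← Equiv.prod_comp (vectorSnocEquiv m), Fintype.prod_prod_type]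
  rfl

/-- The action on words of length m + 1 first permutes the last symbol over each prefix, then
permutes the prefixes. The second factor acts on three copies of the words of length m, so its sign
is sgn_m³ = sgn_m and cancels against the extra sgn_m. -/
theorem sgn_succ_mul_sgn (m : ℕ) (σ : TreeAut) (y : List (Fin 3)) :
    sgn (m + 1) σ y * sgn m σ y =
      ∏ w : List.Vector (Fin 3) m, Equiv.Perm.sign (childPerm σ (y ++ w.1)) := by
  have h : sgn (m + 1) σ y = Equiv.Perm.sign
      ((Equiv.prodCongrLeft fun _ : Fin 3 => permAbove m σ y) *
        (Equiv.prodCongrRight fun w : List.Vector (Fin 3) m => childPerm σ (y ++ w.1)) :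
          Equiv.Perm (List.Vector (Fin 3) m × Fin 3)) := by
    symm
    refine Equiv.Perm.sign_eq_sign_of_equiv _ _ (vectorSnocEquiv m) ?_
    rintro ⟨w, i⟩
    apply Subtype.ext
    apply List.append_cancel_left (as := σ.1 y)
    rw [← permAbove_spec]
    change σ.1 y ++ ((permAbove m σ y w).1 ++ [childPerm σ (y ++ w.1) i]) =
      σ.1 (y ++ (w.1 ++ [i]))
    rw [← List.append_assoc, ← List.append_assoc, childPerm_spec, permAbove_spec]
  rw [h, Equiv.Perm.sign_mul, Equiv.Perm.sign_prodCongrLeft, Equiv.Perm.sign_prodCongrRight,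
    Finset.prod_const, Finset.card_univ, Fintype.card_fin]
  change sgn m σ y ^ 3 * _ * sgn m σ y = _
  rcases Int.units_eq_one_or (sgn m σ y) with h1 | h1 <;> simp [h1, pow_succ]

end Sign

/-! ### Critical points and rationality of the collision value. -/

section Critical

open Polynomial

variable {K : Type*} [Field K] {F : Type*} [Field F] [Algebra K F]

theorem three_ne_zero_of_ringChar (hchar : ¬ ringChar K ∣ 6) : (3 : K) ≠ 0 := fun h =>
  hchar (((ringChar.spec K 3).mp (by exact_mod_cast h)).trans (by norm_num))

theorem two_ne_zero_of_ringChar (hchar : ¬ ringChar K ∣ 6) : (2 : K) ≠ 0 := fun h =>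
  hchar (((ringChar.spec K 2).mp (by exact_mod_cast h)).trans (by norm_num))

theorem polyMap_iterate_eq_aeval (f : K[X]) (n : ℕ) (z : F) :
    (polyMap f)^[n] z = aeval z (f.comp^[n] X) := by
  induction n with
  | zero => simp
  | succ n ih =>
    rw [Function.iterate_succ_apply', Function.iterate_succ_apply', ih, aeval_comp, polyMap]

theorem aeval_derivative_cubic {f : K[X]} (hf : f.natDegree = 3) {γ₁ γ₂ : F} (hne : γ₁ ≠ γ₂)
    (h₁ : aeval γ₁ (derivative f) = 0) (h₂ : aeval γ₂ (derivative f) = 0) (x : F) :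
    aeval x (derivative f) =
      3 * algebraMap K F f.leadingCoeff * (x - γ₁) * (x - γ₂) := by
  have key (z : F) : aeval z (derivative f) = algebraMap K F (f.coeff 1) +
      2 * algebraMap K F (f.coeff 2) * z + 3 * algebraMap K F f.leadingCoeff * z ^ 2 := by
    have hd : (derivative f).natDegree < 3 := by
      have := natDegree_derivative_le f
      omega
    rw [aeval_eq_sum_range' hd, leadingCoeff, hf]
    simp [Finset.sum_range_succ, coeff_derivative, Algebra.smul_def]
    ring
  rw [key] at h₁ h₂
  rw [key]
  have h3 : 2 * algebraMap K F (f.coeff 2) +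
      3 * algebraMap K F f.leadingCoeff * (γ₁ + γ₂) = 0 := by
    -- The difference of the two critical equations is γ₁ - γ₂ times the sum-of-roots relation.
    apply mul_left_cancel₀ (sub_ne_zero.mpr hne)
    linear_combination h₁ - h₂
  linear_combination h₁ + (x - γ₁) * h3

/-- Modulo f', p is a linear polynomial u X + v over K; equal values at two distinct roots of f'
force u = 0, so the value is v. No separate descent for conjugate γ₁, γ₂ is needed. -/
theorem exists_aeval_eq_of_collide {f : K[X]} (hf : f.natDegree = 3) (h3 : (3 : K) ≠ 0)
    {γ₁ γ₂ : F} (hne : γ₁ ≠ γ₂) (h₁ : aeval γ₁ (derivative f) = 0)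
    (h₂ : aeval γ₂ (derivative f) = 0) {p : K[X]} (hp : aeval γ₁ p = aeval γ₂ p) :
    ∃ c : K, aeval γ₁ p = algebraMap K F c := by
  have hd0 : derivative f ≠ 0 := fun h => by
    have := congrArg (coeff · 2) h
    simp only [coeff_derivative, coeff_zero] at this
    have hl : f.coeff 3 ≠ 0 := by
      rw [← hf]
      exact leadingCoeff_ne_zero.mpr (by rintro rfl; simp at hf)
    norm_num [hl, h3] at this
  have hdeg : (p % derivative f).degree ≤ 1 := by
    have hlt := degree_mod_lt p hd0
    have h4 : (derivative f).degree ≤ 2 := by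
      refine (degree_le_of_natDegree_le (n := 2) ?_)
      have := natDegree_derivative_le f
      omega
    have h5 : (p % derivative f).degree < ((2 : ℕ) : WithBot ℕ) := hlt.trans_le h4
    exact Order.le_of_lt_succ (h5.trans_le (by decide))
  obtain ⟨u, v, huv⟩ : ∃ u v : K, p % derivative f = C u * X + C v :=
    ⟨_, _, eq_X_add_C_of_degree_le_one hdeg⟩
  have red (γ : F) (h : aeval γ (derivative f) = 0) :
      aeval γ p = algebraMap K F u * γ + algebraMap K F v := by
    conv_lhs => rw [← EuclideanDomain.div_add_mod p (derivative f)]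
    simp [huv, h]
  rw [red γ₁ h₁, red γ₂ h₂] at hp
  have hu : algebraMap K F u = 0 := by
    apply (mul_eq_zero.mp _).resolve_right (sub_ne_zero.mpr hne)
    linear_combination hp
  exact ⟨v, by rw [red γ₁ h₁, hu]; ring⟩

end Critical

/-! ### Fibers, discriminants and trees of preimages. -/

section Branching

open Polynomial

variable {K : Type*} [Field K] {F : Type*} [Field F] [Algebra K F]

/-- The Vandermonde determinant of three elements. -/
def vdet (r : Fin 3 → F) : F := (Matrix.vandermonde r).det

theorem vdet_eq (r : Fin 3 → F) : vdet r = (r 1 - r 0) * (r 2 - r 0) * (r 2 - r 1) := by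
  rw [vdet, Matrix.det_vandermonde]
  simp [Fin.prod_univ_three, show Finset.Ioi (0 : Fin 3) = {1, 2} by decide,
    show Finset.Ioi (1 : Fin 3) = {2} by decide, show Finset.Ioi (2 : Fin 3) = ∅ by decide]

theorem vdet_ne_zero_iff {r : Fin 3 → F} : vdet r ≠ 0 ↔ Function.Injective r :=
  Matrix.det_vandermonde_ne_zero_iff

theorem vdet_perm (r : Fin 3 → F) (π : Equiv.Perm (Fin 3)) :
    vdet (fun i => r (π i)) = ((Equiv.Perm.sign π : ℤ) : F) * vdet r :=
  Matrix.det_permute π (Matrix.vandermonde r)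

theorem map_vdet {S : Type*} [Field S] (φ : F →+* S) (r : Fin 3 → F) :
    φ (vdet r) = vdet fun i => φ (r i) := by
  simp [vdet_eq]

/-- `r` lists the preimages of `z` under `f`, with multiplicity. -/
def IsFiber (f : K[X]) (z : F) (r : Fin 3 → F) : Prop :=
  ∀ x, polyMap f x - z = algebraMap K F f.leadingCoeff * ∏ i, (x - r i)

theorem IsFiber.polyMap_eq {f : K[X]} {z : F} {r : Fin 3 → F} (h : IsFiber f z r) (i : Fin 3) :
    polyMap f (r i) = z := by
  have := h (r i)
  rwa [Finset.prod_eq_zero (Finset.mem_univ i) (sub_self _), mul_zero, sub_eq_zero] at this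

theorem leadingCoeff_ne_zero_of_cubic {f : K[X]} (hf : f.natDegree = 3) :
    algebraMap K F f.leadingCoeff ≠ 0 := by
  rw [Ne, FaithfulSMul.algebraMap_eq_zero_iff, leadingCoeff_eq_zero]
  rintro rfl
  simp at hf

theorem IsFiber.exists_eq {f : K[X]} (hf : f.natDegree = 3) {z : F} {r : Fin 3 → F}
    (h : IsFiber f z r) {x : F} (hx : polyMap f x = z) : ∃ i, x = r i := by
  have h1 := h x
  rw [hx, sub_self, eq_comm, mul_eq_zero, Finset.prod_eq_zero_iff] at h1
  obtain ⟨i, -, hi⟩ := h1.resolve_left (leadingCoeff_ne_zero_of_cubic hf)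
  exact ⟨i, sub_eq_zero.mp hi⟩

theorem IsFiber.perm {f : K[X]} {z : F} {r : Fin 3 → F} (h : IsFiber f z r)
    (π : Equiv.Perm (Fin 3)) : IsFiber f z fun i => r (π i) := fun x => by
  rw [h x, Equiv.prod_comp π fun i => x - r i]

theorem exists_isFiber [IsAlgClosed F] {f : K[X]} (hf : f.natDegree = 3) (z : F) :
    ∃ r : Fin 3 → F, IsFiber f z r := by
  set p : F[X] := f.map (algebraMap K F) - C z with hp
  have hlt : (C z).degree < (f.map (algebraMap K F)).degree := by
    refine degree_C_le.trans_lt ?_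
    rw [degree_map, degree_eq_natDegree (by rintro rfl; simp at hf), hf]
    decide
  have hlead : p.leadingCoeff = algebraMap K F f.leadingCoeff := by
    rw [hp, leadingCoeff_sub_of_degree_lt hlt, leadingCoeff_map]
  have hdeg : p.natDegree = 3 := by rw [hp, natDegree_sub_C, natDegree_map, hf]
  have hs := IsAlgClosed.splits p
  have hcard := hs.natDegree_eq_card_roots
  rw [hdeg, eq_comm, Multiset.card_eq_three] at hcard
  obtain ⟨a, b, c, habc⟩ := hcard
  refine ⟨![a, b, c], fun x => ?_⟩
  have h := congrArg (eval x) hs.eq_prod_roots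
  rw [hlead, habc] at h
  simp only [hp, eval_sub, eval_map_algebraMap, eval_C, eval_mul, Multiset.insert_eq_cons,
    Multiset.map_cons, Multiset.map_singleton, Multiset.prod_cons, Multiset.prod_singleton,
    eval_X] at h
  rw [polyMap, h]
  simp [Fin.prod_univ_three, mul_assoc]

theorem IsFiber.of_injective [IsAlgClosed F] {f : K[X]} (hf : f.natDegree = 3) {z : F}
    {r : Fin 3 → F} (hr : Function.Injective r) (h : ∀ i, polyMap f (r i) = z) :
    IsFiber f z r := by
  obtain ⟨r', hr'⟩ := exists_isFiber hf z
  choose g hg using fun i => hr'.exists_eq hf (h i)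
  have hg' : Function.Injective g := fun i j hij => hr (by rw [hg i, hg j, hij])
  have := hr'.perm (Equiv.ofBijective g (Finite.injective_iff_bijective.mp hg'))
  convert this using 2 with i
  exact hg i

/-- The classical identity between the discriminant and the product of the values of f' at the
roots: f' is computed from the factorization over the fiber and from its factorization over the
critical points, and the two are compared at each root. -/
theorem IsFiber.sq_vdet [Infinite F] {f : K[X]} (hf : f.natDegree = 3)
    {γ₁ γ₂ : F}
    (hd : ∀ x, aeval x (derivative f) =
      3 * algebraMap K F f.leadingCoeff * (x - γ₁) * (x - γ₂))
    {z : F} {r : Fin 3 → F} (h : IsFiber f z r) :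
    vdet r ^ 2 = -27 / algebraMap K F f.leadingCoeff ^ 2 *
      ((polyMap f γ₁ - z) * (polyMap f γ₂ - z)) := by
  have ha := leadingCoeff_ne_zero_of_cubic (F := F) hf
  have hpoly : f.map (algebraMap K F) - C z =
      C (algebraMap K F f.leadingCoeff) * ∏ i, (X - C (r i)) := by
    refine Polynomial.funext fun x => ?_
    simpa [polyMap, eval_prod] using h x
  have hder (x : F) : aeval x (derivative f) = algebraMap K F f.leadingCoeff *
      ((x - r 1) * (x - r 2) + (x - r 0) * (x - r 2) + (x - r 0) * (x - r 1)) := by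
    have h4 := congrArg (fun p => eval x (derivative p)) hpoly
    simp only [Fin.prod_univ_three, derivative_sub, derivative_C, derivative_mul, derivative_X,
      derivative_map] at h4
    simp at h4
    rw [h4]
    ring
  have hdiv (x : F) : 3 * ((x - γ₁) * (x - γ₂)) =
      (x - r 1) * (x - r 2) + (x - r 0) * (x - r 2) + (x - r 0) * (x - r 1) := by
    apply mul_left_cancel₀ ha
    rw [← hder, hd]
    ring
  have e0 := hdiv (r 0)
  have e1 := hdiv (r 1)
  have e2 := hdiv (r 2)
  rw [h γ₁, h γ₂, vdet_eq, Fin.prod_univ_three, Fin.prod_univ_three]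
  field_simp
  have hprod : 27 * (((r 0 - γ₁) * (r 0 - γ₂)) * ((r 1 - γ₁) * (r 1 - γ₂)) *
      ((r 2 - γ₁) * (r 2 - γ₂))) = -((r 1 - r 0) * (r 2 - r 0) * (r 2 - r 1)) ^ 2 := by
    calc _ = (3 * ((r 0 - γ₁) * (r 0 - γ₂))) * (3 * ((r 1 - γ₁) * (r 1 - γ₂))) *
          (3 * ((r 2 - γ₁) * (r 2 - γ₂))) := by ring
      _ = _ := by rw [e0, e1, e2]; ring
  linear_combination hprod

/-- A tree of preimages of `nd []` under `f`, the nodes indexed by words. -/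
def Branching (f : K[X]) (nd : List (Fin 3) → F) : Prop :=
  ∀ w, IsFiber f (nd w) fun i => nd (w ++ [i])

theorem Branching.shift {f : K[X]} {nd : List (Fin 3) → F} (h : Branching f nd)
    (u : List (Fin 3)) : Branching f fun w => nd (u ++ w) := fun w => by
  simpa [List.append_assoc] using h (u ++ w)

/-- The leading coefficient of the `m`-th iterate of a cubic with leading coefficient `a`. -/
def iterLead {R : Type*} [Monoid R] (a : R) (m : ℕ) : R := a ^ ∑ i ∈ Finset.range m, 3 ^ i

/-- Induction applied at f(x): each factor f(x) - `nd w` splits over the fiber of `nd w`, and the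
3^m fibers contribute 3^m further leading coefficients. -/
theorem Branching.iterate_sub {f : K[X]} {nd : List (Fin 3) → F} (h : Branching f nd) (m : ℕ)
    (x : F) : (polyMap f)^[m] x - nd [] = iterLead (algebraMap K F f.leadingCoeff) m *
      ∏ w : List.Vector (Fin 3) m, (x - nd w.1) := by
  induction m generalizing x with
  | zero =>
    rw [Fintype.prod_eq_single List.Vector.nil fun w hw => absurd w.eq_nil hw]
    simp [iterLead, show (List.Vector.nil : List.Vector (Fin 3) 0).1 = [] from rfl]
  | succ m ih =>
    rw [Function.iterate_succ_apply, ih, prod_vector_succ m fun w => x - nd w]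
    simp only [fun w => h w x, Finset.prod_mul_distrib]
    rw [Finset.prod_const, Finset.card_univ, card_vector, Fintype.card_fin, iterLead, iterLead,
      Finset.sum_range_succ, pow_add, mul_assoc]

theorem Branching.iterate_eq {f : K[X]} {nd : List (Fin 3) → F} (h : Branching f nd) {m : ℕ}
    (w : List.Vector (Fin 3) m) : (polyMap f)^[m] (nd w.1) = nd [] := by
  have := h.iterate_sub m (nd w.1)
  rwa [Finset.prod_eq_zero (Finset.mem_univ w) (sub_self _), mul_zero, sub_eq_zero] at this

theorem iterLead_ne_zero {f : K[X]} (hf : f.natDegree = 3) (m : ℕ) :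
    iterLead (algebraMap K F f.leadingCoeff) m ≠ 0 :=
  pow_ne_zero _ (leadingCoeff_ne_zero_of_cubic hf)

theorem Branching.exists_eq {f : K[X]} (hf : f.natDegree = 3) {nd : List (Fin 3) → F}
    (h : Branching f nd) {m : ℕ} {x : F} (hx : (polyMap f)^[m] x = nd []) :
    ∃ w : List.Vector (Fin 3) m, nd w.1 = x := by
  have h1 := h.iterate_sub m x
  rw [hx, sub_self, eq_comm, mul_eq_zero, Finset.prod_eq_zero_iff] at h1
  obtain ⟨i, -, hi⟩ := h1.resolve_left (iterLead_ne_zero hf m)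
  exact ⟨i, (sub_eq_zero.mp hi).symm⟩

/-- `z` is not in the forward orbit of the critical values `f γ₁`, `f γ₂`. -/
def NotPostcritical (f : K[X]) (γ₁ γ₂ z : F) : Prop :=
  ∀ n : ℕ, 1 ≤ n → (polyMap f)^[n] γ₁ ≠ z ∧ (polyMap f)^[n] γ₂ ≠ z

theorem NotPostcritical.of_polyMap {f : K[X]} {γ₁ γ₂ z : F}
    (h : NotPostcritical f γ₁ γ₂ (polyMap f z)) : NotPostcritical f γ₁ γ₂ z := fun n _ => by
  have h1 := h (n + 1) (by omega)
  rw [Function.iterate_succ_apply', Function.iterate_succ_apply'] at h1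
  exact ⟨fun h2 => h1.1 (by rw [h2]), fun h2 => h1.2 (by rw [h2])⟩

theorem Branching.notPostcritical {f : K[X]} {γ₁ γ₂ : F} {nd : List (Fin 3) → F}
    (h : Branching f nd) (h0 : NotPostcritical f γ₁ γ₂ (nd [])) (w : List (Fin 3)) :
    NotPostcritical f γ₁ γ₂ (nd w) := by
  induction w using List.reverseRecOn with
  | nil => exact h0
  | append_singleton w i ih =>
    rw [← (h w).polyMap_eq i] at ih
    exact ih.of_polyMap

theorem IsFiber.injective [Infinite F] {f : K[X]} (hf : f.natDegree = 3) (h3 : (3 : F) ≠ 0)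
    {γ₁ γ₂ : F}
    (hd : ∀ x, aeval x (derivative f) =
      3 * algebraMap K F f.leadingCoeff * (x - γ₁) * (x - γ₂))
    {z : F} {r : Fin 3 → F} (h : IsFiber f z r) (hz : NotPostcritical f γ₁ γ₂ z) :
    Function.Injective r := by
  rw [← vdet_ne_zero_iff, ← pow_ne_zero_iff two_ne_zero, h.sq_vdet hf hd]
  have h27 : (-27 : F) ≠ 0 := by
    rw [show (-27 : F) = -3 ^ 3 by norm_num]
    exact neg_ne_zero.mpr (pow_ne_zero _ h3)
  obtain ⟨h1, h2⟩ := hz 1 le_rfl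
  exact mul_ne_zero (div_ne_zero h27 (pow_ne_zero _ (leadingCoeff_ne_zero_of_cubic hf)))
    (mul_ne_zero (sub_ne_zero.mpr h1) (sub_ne_zero.mpr h2))

theorem Branching.injective [Infinite F] {f : K[X]} (hf : f.natDegree = 3) (h3 : (3 : F) ≠ 0)
    {γ₁ γ₂ : F}
    (hd : ∀ x, aeval x (derivative f) =
      3 * algebraMap K F f.leadingCoeff * (x - γ₁) * (x - γ₂))
    {nd : List (Fin 3) → F} (h : Branching f nd) (h0 : NotPostcritical f γ₁ γ₂ (nd []))
    {w w' : List (Fin 3)} (hlen : w.length = w'.length) (heq : nd w = nd w') : w = w' := by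
  induction w using List.reverseRecOn generalizing w' with
  | nil => exact (List.length_eq_zero_iff.mp hlen.symm).symm
  | append_singleton w i ih =>
    rcases List.eq_nil_or_concat' w' with rfl | ⟨w', j, rfl⟩
    · simp at hlen
    · have hf' := congrArg (polyMap f) heq
      rw [(h w).polyMap_eq i, (h w').polyMap_eq j] at hf'
      obtain rfl := ih (by simpa using hlen) hf'
      have := (h w).injective hf h3 hd (h.notPostcritical h0 w) heq
      rw [this]

/-- Two trees of preimages with the same root have the same nodes at each level. -/
theorem Branching.prod_eq [Infinite F] {f : K[X]} (hf : f.natDegree = 3) (h3 : (3 : F) ≠ 0)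
    {γ₁ γ₂ : F}
    (hd : ∀ x, aeval x (derivative f) =
      3 * algebraMap K F f.leadingCoeff * (x - γ₁) * (x - γ₂))
    {nd nd' : List (Fin 3) → F} (h : Branching f nd) (h' : Branching f nd')
    (h0 : NotPostcritical f γ₁ γ₂ (nd [])) (heq : nd [] = nd' []) (m : ℕ) (g : F → F) :
    ∏ w : List.Vector (Fin 3) m, g (nd w.1) = ∏ w : List.Vector (Fin 3) m, g (nd' w.1) := by
  classical
  have inj {nd : List (Fin 3) → F} (h : Branching f nd)
      (h0 : NotPostcritical f γ₁ γ₂ (nd [])) :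
      Function.Injective fun w : List.Vector (Fin 3) m => nd w.1 := fun w w' hw =>
    Subtype.ext (h.injective hf h3 hd h0 (w.2.trans w'.2.symm) hw)
  rw [← Finset.prod_image (f := g) (inj h h0).injOn,
    ← Finset.prod_image (f := g) (inj h' (heq ▸ h0)).injOn]
  congr 1
  ext x
  simp only [Finset.mem_image, Finset.mem_univ, true_and]
  constructor
  · rintro ⟨w, rfl⟩
    exact h'.exists_eq hf ((h.iterate_eq w).trans heq)
  · rintro ⟨w, rfl⟩
    exact h.exists_eq hf ((h'.iterate_eq w).trans heq.symm)

/-- The product of the differences of the siblings over all sibling triples at relative level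
`m + 1` above `u`. -/
def levelDet (nd : List (Fin 3) → F) (m : ℕ) (u : List (Fin 3)) : F :=
  ∏ w : List.Vector (Fin 3) m, vdet fun i => nd (u ++ w.1 ++ [i])

/-- The factor `k` in the formula `-3 (k (c - y))²` for the square of `levelDet`. -/
def levelScale (f : K[X]) (m : ℕ) : K :=
  3 / f.leadingCoeff * (-27 / f.leadingCoeff ^ 2) ^ (3 ^ m / 2) / iterLead f.leadingCoeff m

theorem levelScale_ne_zero {f : K[X]} (hf : f.natDegree = 3) (h3 : (3 : K) ≠ 0) (m : ℕ) :
    levelScale f m ≠ 0 := by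
  have ha := leadingCoeff_ne_zero_of_cubic (F := K) hf
  have h27 : (-27 : K) ≠ 0 := by
    rw [show (-27 : K) = -3 ^ 3 by norm_num]
    exact neg_ne_zero.mpr (pow_ne_zero _ h3)
  exact div_ne_zero (mul_ne_zero (div_ne_zero h3 ha) (pow_ne_zero _ (div_ne_zero h27
    (pow_ne_zero _ ha)))) (iterLead_ne_zero (F := K) hf m)

/-- The only place where the collision enters the determinants: both critical points contribute the
same factor c - `nd u`, so everything but one factor -27 is a square. -/
theorem Branching.sq_levelDet [Infinite F] {f : K[X]} (hf : f.natDegree = 3)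
    {γ₁ γ₂ : F}
    (hd : ∀ x, aeval x (derivative f) =
      3 * algebraMap K F f.leadingCoeff * (x - γ₁) * (x - γ₂))
    {nd : List (Fin 3) → F} (h : Branching f nd) {m : ℕ} {c : F}
    (hc₁ : (polyMap f)^[m + 1] γ₁ = c) (hc₂ : (polyMap f)^[m + 1] γ₂ = c) (u : List (Fin 3)) :
    levelDet nd m u ^ 2 = -3 * (algebraMap K F (levelScale f m) * (c - nd u)) ^ 2 := by
  have ha := leadingCoeff_ne_zero_of_cubic (F := F) hf
  have hA := iterLead_ne_zero (F := F) hf m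
  have hprod (γ : F) (hγ : (polyMap f)^[m + 1] γ = c) :
      ∏ w : List.Vector (Fin 3) m, (polyMap f γ - nd (u ++ w.1)) =
        (c - nd u) / iterLead (algebraMap K F f.leadingCoeff) m := by
    rw [eq_div_iff hA, mul_comm, ← hγ, Function.iterate_succ_apply]
    simpa using ((h.shift u).iterate_sub m (polyMap f γ)).symm
  rw [levelDet, ← Finset.prod_pow]
  simp only [fun w => (h w).sq_vdet hf hd]
  rw [Finset.prod_mul_distrib, Finset.prod_mul_distrib, hprod γ₁ hc₁, hprod γ₂ hc₂,
    Finset.prod_const, Finset.card_univ, card_vector, Fintype.card_fin]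
  -- There are 3^m fibers, an odd number. The unpaired -27/a² equals -3 (3/a)², whence the factor
  -- 3/a in `levelScale`.
  have hodd : 3 ^ m = 2 * (3 ^ m / 2) + 1 := by
    have : Odd (3 ^ m) := Odd.pow (by decide)
    obtain ⟨q, hq⟩ := this
    omega
  have hmap : algebraMap K F (iterLead f.leadingCoeff m) =
      iterLead (algebraMap K F f.leadingCoeff) m := map_pow _ _ _
  rw [levelScale]
  simp only [map_mul, map_div₀, map_pow, map_neg, map_ofNat, hmap]
  generalize hq : 3 ^ m / 2 = q at *
  rw [hodd, pow_succ, mul_comm 2 q, pow_mul]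
  field_simp
  ring

end Branching

/-! ### A coherent choice of orderings of the fibers. -/

section Oriented

open Polynomial

variable {K : Type*} [Field K] {F : Type*} [Field F] [Algebra K F]

theorem Branching.foldl {f : K[X]} {e : F → Fin 3 → F} (he : ∀ z, IsFiber f z (e z)) (y : F) :
    Branching f fun w => w.foldl e y := fun w => by
  simpa [List.foldl_append] using he (w.foldl e y)

/-- The tree of preimages can be ordered so that all `levelDet` are given by one square root
of `-3`. -/
theorem exists_oriented_branching [IsAlgClosed F] {f : K[X]} (hf : f.natDegree = 3)
    (h3 : (3 : F) ≠ 0) {γ₁ γ₂ : F}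
    (hd : ∀ x, aeval x (derivative f) =
      3 * algebraMap K F f.leadingCoeff * (x - γ₁) * (x - γ₂))
    {m : ℕ} {c : F} (hc₁ : (polyMap f)^[m + 1] γ₁ = c) (hc₂ : (polyMap f)^[m + 1] γ₂ = c)
    {x₀ : F} (hx₀ : NotPostcritical f γ₁ γ₂ x₀) {s : F} (hs : s ^ 2 = -3) :
    ∃ nd : List (Fin 3) → F, Branching f nd ∧ nd [] = x₀ ∧
      ∀ u, levelDet nd m u = s * (algebraMap K F (levelScale f m) * (c - nd u)) := by
  classical
  have : Infinite F := IsAlgClosed.instInfinite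
  choose r hr using exists_isFiber (F := F) hf
  -- T is the prescribed value and D the value for the reference orderings r; they agree up to sign.
  set T : F → F := fun y => s * (algebraMap K F (levelScale f m) * (c - y)) with hT
  set D : F → F := fun y => ∏ w : List.Vector (Fin 3) m, vdet (r (w.1.foldl r y)) with hD
  have hDT (y : F) : D y = T y ∨ D y = -T y := by
    rw [← sq_eq_sq_iff_eq_or_eq_neg, hT, mul_pow, hs]
    have := (Branching.foldl hr y).sq_levelDet hf hd hc₁ hc₂ []
    simpa [levelDet, List.foldl_append, hD] using this
  -- One transposition corrects the sign at y, applied in the fiber over the node 0…0 of the r-tree,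
  -- m levels above y. Since y = f^m(z), the ordering at z depends on z alone. Both D and this node
  -- refer to r, so corrections at different y do not interfere and no recursion is needed.
  set w₀ : List.Vector (Fin 3) m := List.Vector.replicate m 0 with hw₀
  set e : F → Fin 3 → F := fun z =>
    if z = w₀.1.foldl r ((polyMap f)^[m] z) ∧ D ((polyMap f)^[m] z) ≠ T ((polyMap f)^[m] z) then
      fun i => r z (Equiv.swap 0 1 i) else r z with he
  have hefib (z : F) : IsFiber f z (e z) := by
    simp only [he]
    split_ifs
    · exact (hr z).perm _
    · exact hr z
  refine ⟨fun w => w.foldl e x₀, Branching.foldl hefib x₀, rfl, fun u => ?_⟩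
  have hb := Branching.foldl hefib x₀
  set y : F := u.foldl e x₀ with hy
  have hy₀ : NotPostcritical f γ₁ γ₂ y := hb.notPostcritical hx₀ u
  have hRy := Branching.foldl hr y
  have hvd (w : List.Vector (Fin 3) m) : vdet (e (w.1.foldl r y)) =
      (if w = w₀ then (if D y ≠ T y then -1 else 1) else 1) * vdet (r (w.1.foldl r y)) := by
    have hit : (polyMap f)^[m] (w.1.foldl r y) = y := hRy.iterate_eq w
    have hiff : w.1.foldl r y = w₀.1.foldl r y ↔ w = w₀ :=
      ⟨fun h => Subtype.ext (hRy.injective hf h3 hd hy₀ (w.2.trans w₀.2.symm) h),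
        fun h => by rw [h]⟩
    simp only [he, hit, hiff]
    by_cases h1 : w = w₀ <;> by_cases h2 : D y = T y <;> simp [h1, h2, vdet_perm]
  calc levelDet (fun w => w.foldl e x₀) m u
      = ∏ w : List.Vector (Fin 3) m, vdet (e (w.1.foldl e y)) := by
        simp [levelDet, List.foldl_append, hy]
    -- Reordering lower fibers only permutes the nodes m levels above y, so the product may run over
    -- the r-tree.
    _ = ∏ w : List.Vector (Fin 3) m, vdet (e (w.1.foldl r y)) :=
        (Branching.foldl hefib y).prod_eq hf h3 hd hRy hy₀ rfl m fun z => vdet (e z)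
    _ = (if D y ≠ T y then -1 else 1) * D y := by
        simp only [hvd, Finset.prod_mul_distrib, Finset.prod_ite_eq', Finset.mem_univ, if_true,
          hD]
    _ = T y := by
        by_cases h : D y = T y
        · simp [h]
        · rw [if_pos h, neg_one_mul, (hDT y).resolve_left h, neg_neg]

end Oriented

/-! ### Labelings and the resulting Galois action on words. -/

section Labelings

open Polynomial

variable {K : Type*} [Field K] {F : Type*} [Field F] [Algebra K F] {f : K[X]} {x₀ : K}

theorem BackwardOrbit.ext {v v' : BackwardOrbit F f x₀} (h₁ : v.1 = v'.1)
    (h₂ : v.2.1 = v'.2.1) : v = v' := by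
  obtain ⟨n, y, hy⟩ := v
  obtain ⟨n', y', hy'⟩ := v'
  obtain rfl : n = n' := h₁
  obtain rfl : y = y' := h₂
  rfl

/-- The element of the field with a given label. -/
def Labeling.node (L : Labeling f x₀ F) (w : List (Fin 3)) : F := (L.label.symm w).2.1

theorem Labeling.label_root (L : Labeling f x₀ F) (y) : L.label ⟨0, y⟩ = [] := by
  have h := congrArg List.length (L.label_parent ⟨0, y⟩)
  change (L.label ⟨0, y⟩).length = _ at h
  rw [List.length_dropLast] at h
  exact List.length_eq_zero_iff.mp (by omega)

theorem Labeling.length_label (L : Labeling f x₀ F) (v : BackwardOrbit F f x₀) :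
    (L.label v).length = v.1 := by
  obtain ⟨n, y⟩ := v
  induction n with
  | zero => rw [L.label_root]; rfl
  | succ n ih =>
    have h := congrArg List.length (L.label_parent ⟨n + 1, y⟩)
    rw [List.length_dropLast] at h
    have h1 : L.label ⟨n + 1, y⟩ ≠ [] := fun h2 => by
      rw [← L.label_root ⟨algebraMap K F x₀, by simp⟩] at h2
      have := congrArg Sigma.fst (L.label.injective h2)
      simp at this
    have h2 := List.length_pos_iff.mpr h1
    have h3 : (L.label (BackwardOrbit.parent ⟨n + 1, y⟩)).length = n := ih _
    change _ = n + 1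
    omega

theorem Labeling.node_nil (L : Labeling f x₀ F) : L.node [] = algebraMap K F x₀ := by
  have h : L.label.symm [] = ⟨0, ⟨algebraMap K F x₀, by simp⟩⟩ :=
    L.label.symm_apply_eq.mpr (L.label_root _).symm
  rw [Labeling.node, h]

theorem Labeling.level_symm (L : Labeling f x₀ F) (w : List (Fin 3)) :
    (L.label.symm w).1 = w.length := by
  rw [← L.length_label, Equiv.apply_symm_apply]

theorem BackwardOrbit.polyMap_eq_parent {v : BackwardOrbit F f x₀} {n : ℕ} (h : v.1 = n + 1) :
    polyMap f v.2.1 = v.parent.2.1 := by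
  obtain ⟨n', y⟩ := v
  obtain rfl : n' = n + 1 := h
  rfl

theorem Labeling.polyMap_node (L : Labeling f x₀ F) (w : List (Fin 3)) (i : Fin 3) :
    polyMap f (L.node (w ++ [i])) = L.node w := by
  have hlev : (L.label.symm (w ++ [i])).1 = w.length + 1 := by
    rw [L.level_symm]
    simp
  rw [Labeling.node, BackwardOrbit.polyMap_eq_parent hlev, Labeling.node]
  have : (L.label.symm (w ++ [i])).parent = L.label.symm w := by
    rw [Equiv.eq_symm_apply, L.label_parent]
    simp
  rw [this]

/-- Distinct labels at one level are distinct elements of the field, and three distinct preimages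
exhaust the fiber of a cubic. Thus the discriminant formula applies to an arbitrary labeling. -/
theorem Labeling.branching [IsAlgClosed F] (hf : f.natDegree = 3) (L : Labeling f x₀ F) :
    Branching f L.node := fun w => by
  refine IsFiber.of_injective hf (fun i j hij => ?_) (L.polyMap_node w)
  have h := L.label.symm.injective (BackwardOrbit.ext
    (by rw [L.level_symm, L.level_symm]; simp) hij : L.label.symm (w ++ [i]) = _)
  simpa using h

theorem Branching.iterate_node {nd : List (Fin 3) → F} (h : Branching f nd) (w : List (Fin 3)) :
    (polyMap f)^[w.length] (nd w) = nd [] :=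
  h.iterate_eq ⟨w, rfl⟩

theorem Branching.exists_labeling [Infinite F] (hf : f.natDegree = 3) (h3 : (3 : F) ≠ 0)
    {γ₁ γ₂ : F}
    (hd : ∀ x, aeval x (derivative f) =
      3 * algebraMap K F f.leadingCoeff * (x - γ₁) * (x - γ₂))
    {nd : List (Fin 3) → F} (h : Branching f nd) (h0 : nd [] = algebraMap K F x₀)
    (hx₀ : NotPostcritical f γ₁ γ₂ (algebraMap K F x₀)) :
    ∃ L : Labeling f x₀ F, L.node = nd := by
  set g : List (Fin 3) → BackwardOrbit F f x₀ := fun w =>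
    ⟨w.length, ⟨nd w, (h.iterate_node w).trans h0⟩⟩ with hg
  have hbij : Function.Bijective g := by
    constructor
    · intro w w' hw
      have h1 : w.length = w'.length := congrArg Sigma.fst hw
      have h2 : nd w = nd w' := congrArg (fun v : BackwardOrbit F f x₀ => v.2.1) hw
      exact h.injective hf h3 hd (h0 ▸ hx₀) h1 h2
    · rintro ⟨n, y, hy⟩
      obtain ⟨w, hw⟩ := h.exists_eq hf (hy.trans h0.symm)
      exact ⟨w.1, BackwardOrbit.ext w.2 hw⟩
  refine ⟨⟨(Equiv.ofBijective g hbij).symm, fun v => ?_⟩, rfl⟩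
  obtain ⟨w, rfl⟩ := hbij.2 v
  rw [Equiv.symm_apply_eq, show (Equiv.ofBijective g hbij).symm (g w) = w from
    (Equiv.ofBijective g hbij).symm_apply_apply w]
  rcases List.eq_nil_or_concat' w with rfl | ⟨w, i, rfl⟩
  · rfl
  · rw [List.dropLast_concat]
    have hlev : (g (w ++ [i])).1 = w.length + 1 := by simp [hg]
    refine BackwardOrbit.ext ?_ ?_
    · change (BackwardOrbit.parent ⟨(w ++ [i]).length, _⟩).1 = w.length
      generalize_proofs hp
      have aux : ∀ v : BackwardOrbit F f x₀, v.1 = w.length + 1 → v.parent.1 = w.length := by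
        rintro ⟨n, y⟩ hn
        obtain rfl : n = w.length + 1 := hn
        rfl
      exact aux _ hlev
    · rw [← BackwardOrbit.polyMap_eq_parent hlev]
      exact (h w).polyMap_eq i

/-- The action on the nodes, read off in a labeling. -/
noncomputable def Labeling.hom (L : Labeling f x₀ F) : ArborealGroup F f x₀ →* TreeAut where
  toFun σ := ⟨L.label.permCongr (MulAction.toPerm σ), fun w => by
    obtain ⟨v, rfl⟩ := L.label.surjective w
    rw [← L.label_parent]
    simp only [Equiv.permCongr_apply, Equiv.symm_apply_apply, MulAction.toPerm_apply]
    rw [← L.label_parent]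
    congr 1
    obtain ⟨n, y⟩ := v
    cases n with
    | zero => rfl
    | succ n =>
      refine BackwardOrbit.ext rfl ?_
      have hz := BackwardOrbit.mem_arborealField ⟨n + 1, y⟩
      have hz' := BackwardOrbit.mem_arborealField (BackwardOrbit.parent ⟨n + 1, y⟩)
      let z : arborealField F f x₀ := ⟨y.1, hz⟩
      have h : (⟨polyMap f y.1, hz'⟩ : arborealField F f x₀) = polyMap f z :=
        Subtype.ext (aeval_algHom_apply (arborealField F f x₀).val z f)
      change (σ ⟨polyMap f y.1, hz'⟩ : F) = polyMap f (σ z : F)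
      rw [h]
      exact (aeval_algHom_apply ((arborealField F f x₀).val.comp σ.toAlgHom) z f).symm⟩
  map_one' := Subtype.ext <| Equiv.ext fun w => by simp
  map_mul' σ τ := Subtype.ext <| Equiv.ext fun w => by simp [mul_smul]

theorem Labeling.hom_label (L : Labeling f x₀ F) (σ : ArborealGroup F f x₀)
    (v : BackwardOrbit F f x₀) : (L.hom σ).1 (L.label v) = L.label (σ • v) := by
  change L.label.permCongr (MulAction.toPerm σ) (L.label v) = _
  simp

/-- An automorphism in the kernel fixes every node, and the nodes generate `arborealField`. -/
theorem Labeling.hom_injective (L : Labeling f x₀ F) : Function.Injective L.hom := by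
  rw [injective_iff_map_eq_one]
  have hv (σ : ArborealGroup F f x₀) (hσ : L.hom σ = 1) (v : BackwardOrbit F f x₀) :
      σ • v = v := by
    apply L.label.injective
    rw [← L.hom_label, hσ]
    rfl
  have hle : arborealField F f x₀ ≤
      IntermediateField.lift (IntermediateField.fixedField L.hom.ker) := by
    refine iSup_le fun n => IntermediateField.adjoin_le_iff.mpr fun y hy => ?_
    let v : BackwardOrbit F f x₀ := ⟨n, ⟨y, hy⟩⟩
    refine (IntermediateField.mem_lift (⟨y, v.mem_arborealField⟩ : arborealField F f x₀)).mpr ?_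
    rintro ⟨τ, hτ⟩
    exact Subtype.ext (congrArg (fun v : BackwardOrbit F f x₀ => v.2.1) (hv τ hτ v))
  intro σ hσ
  refine AlgEquiv.ext fun x => ?_
  exact (IntermediateField.mem_lift x).mp (hle x.2) ⟨σ, hσ⟩

end Labelings

/-! ### Galois action on the determinants and descent to K. -/

section Galois

open Polynomial

variable {K : Type*} [Field K] {F : Type*} [Field F] [Algebra K F] {f : K[X]} {x₀ : K}

/-- The node with a given label, as an element of the arboreal field. -/
noncomputable def Labeling.fieldNode (L : Labeling f x₀ F) (w : List (Fin 3)) :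
    arborealField F f x₀ :=
  ⟨L.node w, (L.label.symm w).mem_arborealField⟩

variable {L : Labeling f x₀ F} {φ : ArborealGroup F f x₀ →* TreeAut}

theorem Labeling.apply_fieldNode
    (hφ : ∀ σ v, (φ σ).1 (L.label v) = L.label (σ • v)) (σ : ArborealGroup F f x₀)
    (w : List (Fin 3)) : σ (L.fieldNode w) = L.fieldNode ((φ σ).1 w) := by
  have h : L.label.symm ((φ σ).1 w) = σ • L.label.symm w := by
    rw [Equiv.symm_apply_eq, ← hφ, Equiv.apply_symm_apply]
  apply Subtype.ext
  change _ = (L.label.symm ((φ σ).1 w)).2.1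
  rw [h]
  rfl

/-- σ carries each fiber above u to a fiber above σ(u), and each Vandermonde determinant picks up
the sign of the induced fiber permutation. -/
theorem Labeling.apply_levelDet
    (hφ : ∀ σ v, (φ σ).1 (L.label v) = L.label (σ • v)) (σ : ArborealGroup F f x₀) (m : ℕ)
    (u : List (Fin 3)) : σ (levelDet L.fieldNode m u) =
      ((sgn (m + 1) (φ σ) u * sgn m (φ σ) u : ℤˣ) : ℤ) *
        levelDet L.fieldNode m ((φ σ).1 u) := by
  have h (w : List.Vector (Fin 3) m) : σ (vdet fun i => L.fieldNode (u ++ w.1 ++ [i])) =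
      ((Equiv.Perm.sign (childPerm (φ σ) (u ++ w.1)) : ℤ) : arborealField F f x₀) *
        vdet fun i => L.fieldNode ((φ σ).1 u ++ (permAbove m (φ σ) u w).1 ++ [i]) := by
    rw [← vdet_perm]
    refine (map_vdet (σ : arborealField F f x₀ →+* arborealField F f x₀) _).trans ?_
    congr 1
    funext i
    refine (L.apply_fieldNode hφ σ _).trans ?_
    rw [childPerm_spec, permAbove_spec]
  rw [levelDet, map_prod]
  simp only [h]
  rw [Finset.prod_mul_distrib, sgn_succ_mul_sgn, Units.coe_prod, Int.cast_prod]
  congr 1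
  exact Equiv.prod_comp (permAbove m (φ σ) u) fun w =>
    vdet fun i => L.fieldNode ((φ σ).1 u ++ w.1 ++ [i])

theorem Labeling.coe_levelDet (L : Labeling f x₀ F) (m : ℕ) (u : List (Fin 3)) :
    ((levelDet L.fieldNode m u : arborealField F f x₀) : F) = levelDet L.node m u := by
  change (arborealField F f x₀).val.toRingHom _ = _
  rw [levelDet, map_prod]
  exact Finset.prod_congr rfl fun w _ => map_vdet _ _

/-- Each level field is the splitting field of fⁿ - x₀, and a supremum of normal subextensions is
normal. -/
theorem normal_arborealField [IsAlgClosed F] (hf : f.natDegree = 3) :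
    Normal K (arborealField F f x₀) := by
  have (n : ℕ) : Normal K (levelField F f x₀ n) := by
    have hdeg : (f.comp^[n] X).natDegree = 3 ^ n := by
      rw [natDegree_iterate_comp, hf, natDegree_X, mul_one]
    set p : K[X] := f.comp^[n] X - C x₀ with hp
    have hp0 : p ≠ 0 := fun h => by
      have h1 : p.natDegree = 3 ^ n := by rw [hp, natDegree_sub_C, hdeg]
      rw [h, natDegree_zero] at h1
      exact absurd h1.symm (by positivity)
    have hset : {y : F | (polyMap f)^[n] y = algebraMap K F x₀} = p.rootSet F := by
      ext y
      rw [mem_rootSet, Set.mem_ofPred_eq, polyMap_iterate_eq_aeval, hp, map_sub, aeval_C,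
        sub_eq_zero]
      exact ⟨fun h => ⟨hp0, h⟩, fun h => h.2⟩
    have := IntermediateField.adjoin_rootSet_isSplittingField
      (IsAlgClosed.splits (p.map (algebraMap K F)))
    rw [levelField, hset]
    exact Normal.of_isSplittingField p
  exact IntermediateField.normal_iSup K F _

/-- An element of a normal extension with square in the base field `K`, fixed by all
automorphisms, has a square root of its square in `K`. -/
theorem isSquare_of_fixed {E : Type*} [Field E] [Algebra K E] [Normal K E] (h2 : (2 : K) ≠ 0)
    {D : E} (hD : D ≠ 0) {d : K} (hd : D ^ 2 = algebraMap K E d)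
    (hfix : ∀ σ : E ≃ₐ[K] E, σ D = D) : IsSquare d := by
  by_contra hsq
  have hirr : Irreducible (X ^ 2 - C d : K[X]) :=
    X_pow_sub_C_irreducible_of_prime Nat.prime_two fun b hb =>
      hsq ⟨b, by rw [← hb, sq]⟩
  have hmin : X ^ 2 - C d = minpoly K D :=
    minpoly.eq_of_irreducible_of_monic hirr (by simp [hd]) (monic_X_pow_sub_C d two_ne_zero)
  -- If d is not a square, then -D is conjugate to D, and normality provides an automorphism
  -- exchanging them.
  obtain ⟨σ, hσ⟩ := minpoly.exists_algEquiv_of_root' (x := -D)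
    (Algebra.IsAlgebraic.isAlgebraic D) (by rw [← hmin]; simp [hd])
  rw [hfix σ] at hσ
  have h2' : (2 : E) ≠ 0 := by
    rw [← map_ofNat (algebraMap K E) 2]
    exact (FaithfulSMul.algebraMap_eq_zero_iff K E).not.mpr h2
  exact mul_ne_zero h2' hD (by linear_combination hσ)

end Galois

end Arboreal

/-! ### Comparison of signs and proof of the theorem. -/

theorem Arboreal.units_eq_of_mul_eq {E : Type*} [Field E] (h2 : (2 : E) ≠ 0) {a b : ℤˣ} {x : E}
    (hx : x ≠ 0) (h : ((a : ℤ) : E) * x = ((b : ℤ) : E) * x) : a = b := by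
  have h1 := mul_right_cancel₀ hx h
  have h3 : (1 : E) ≠ -1 := fun h => h2 (by linear_combination h)
  rcases Int.units_eq_one_or a with rfl | rfl <;> rcases Int.units_eq_one_or b with rfl | rfl
  · rfl
  · exact absurd (by simpa using h1) h3
  · exact absurd (by simpa using h1.symm) h3
  · rfl

theorem theorem1p2 {K : Type*} [Field K] (hchar : ¬ ringChar K ∣ 6)
    {Kbar : Type*} [Field Kbar] [Algebra K Kbar] [IsAlgClosure K Kbar]
    (f : Polynomial K) (hf : f.natDegree = 3)
    (ℓ : ℕ) (hℓ : 2 ≤ ℓ) (γ₁ γ₂ : Kbar) (hγ : Arboreal.CollideAt f γ₁ γ₂ ℓ) :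
    (∃ c : K, (Arboreal.polyMap f)^[ℓ] γ₁ = algebraMap K Kbar c ∧
      (Arboreal.polyMap f)^[ℓ] γ₂ = algebraMap K Kbar c) ∧
    ∀ x₀ : K,
      (∀ n : ℕ, 1 ≤ n → (Arboreal.polyMap f)^[n] γ₁ ≠ algebraMap K Kbar x₀ ∧
        (Arboreal.polyMap f)^[n] γ₂ ≠ algebraMap K Kbar x₀) →
      Arboreal.EmbedsIn Kbar f x₀ (Arboreal.Qtilde ℓ) ∧
      (Arboreal.EmbedsIn Kbar f x₀ (Arboreal.Q ℓ) ↔ IsSquare (-3 : K)) := by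
  open Arboreal in
  have : IsAlgClosed Kbar := IsAlgClosure.isAlgClosed K
  have : Infinite Kbar := IsAlgClosed.instInfinite
  have h3 := three_ne_zero_of_ringChar hchar
  have h2 := two_ne_zero_of_ringChar hchar
  have hmap3 : algebraMap K Kbar 3 = 3 := map_ofNat _ 3
  have h3' : (3 : Kbar) ≠ 0 := by
    rw [← hmap3]
    exact (FaithfulSMul.algebraMap_eq_zero_iff K Kbar).not.mpr h3
  have h2' : (2 : Kbar) ≠ 0 := by
    rw [← map_ofNat (algebraMap K Kbar) 2]
    exact (FaithfulSMul.algebraMap_eq_zero_iff K Kbar).not.mpr h2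
  obtain ⟨-, hc₁, hc₂, heq, hne'⟩ := hγ
  have hne : γ₁ ≠ γ₂ := fun h => hne' (by rw [h])
  have hd := aeval_derivative_cubic hf hne hc₁ hc₂
  obtain ⟨c, hc⟩ : ∃ c : K, (polyMap f)^[ℓ] γ₁ = algebraMap K Kbar c := by
    rw [polyMap_iterate_eq_aeval]
    refine exists_aeval_eq_of_collide hf h3 hne hc₁ hc₂ ?_
    rwa [polyMap_iterate_eq_aeval, polyMap_iterate_eq_aeval] at heq
  have hc' : (polyMap f)^[ℓ] γ₂ = algebraMap K Kbar c := heq ▸ hc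
  refine ⟨⟨c, hc, hc'⟩, fun x₀ hx₀ => ?_⟩
  obtain ⟨m, rfl⟩ : ∃ m, ℓ = m + 1 := ⟨ℓ - 1, by omega⟩
  have hx₀' : NotPostcritical f γ₁ γ₂ (algebraMap K Kbar x₀) := hx₀
  have hk := levelScale_ne_zero hf h3 m
  have hcx : c - x₀ ≠ 0 := sub_ne_zero.mpr fun h => (hx₀ (m + 1) (by omega)).1 (h ▸ hc)
  obtain ⟨s, hs⟩ : ∃ s : Kbar, s ^ 2 = -3 := IsAlgClosed.exists_pow_nat_eq _ two_pos
  obtain ⟨nd, hnd, hnd0, hdet⟩ := exists_oriented_branching hf h3' hd hc hc' hx₀' hs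
  obtain ⟨L, rfl⟩ := hnd.exists_labeling hf h3' hd hnd0 hx₀'
  set F := arborealField Kbar f x₀
  have h2F : (2 : F) ≠ 0 := by
    rw [← map_ofNat (algebraMap K F) 2]
    exact (FaithfulSMul.algebraMap_eq_zero_iff K F).not.mpr h2
  have hs0 : s ≠ 0 := fun h => by
    rw [h, zero_pow two_ne_zero, eq_comm, neg_eq_zero] at hs
    exact h3' hs
  have hDne (u : List (Fin 3)) : levelDet L.fieldNode m u ≠ 0 := fun h => by
    have h1 := L.coe_levelDet m u
    rw [h, hdet] at h1
    have h4 := (hnd.notPostcritical (hnd0 ▸ hx₀') u (m + 1) (by omega)).1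
    rw [hc] at h4
    exact mul_ne_zero hs0 (mul_ne_zero
      ((FaithfulSMul.algebraMap_eq_zero_iff K Kbar).not.mpr hk) (sub_ne_zero.mpr h4)) h1.symm
  -- All `levelDet` are multiples of the one at the root by elements of `K(node)`.
  have hratio (u : List (Fin 3)) : algebraMap K F (c - x₀) * levelDet L.fieldNode m u =
      (algebraMap K F c - L.fieldNode u) * levelDet L.fieldNode m [] := by
    apply Subtype.ext
    change algebraMap K Kbar (c - x₀) * ((levelDet L.fieldNode m u : F) : Kbar) =
      (algebraMap K Kbar c - L.node u) * ((levelDet L.fieldNode m [] : F) : Kbar)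
    rw [L.coe_levelDet, L.coe_levelDet, hdet, hdet, hnd0, map_sub]
    ring
  -- σ applied to `hratio u` is compared with `hratio` at σ(u). The unknown s has been eliminated,
  -- so the two relations differ only by the sign products at u and at the root.
  have hQtilde (σ : ArborealGroup Kbar f x₀) : L.hom σ ∈ Qtilde (m + 1) := fun u => by
    have h1 := congrArg σ (hratio u)
    rw [map_mul, map_mul, map_sub σ, L.apply_levelDet L.hom_label, L.apply_levelDet L.hom_label,
      L.apply_fieldNode L.hom_label, AlgEquiv.commutes, AlgEquiv.commutes, treeAut_nil] at h1
    have h4 := hratio ((L.hom σ).1 u)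
    refine units_eq_of_mul_eq h2F (mul_ne_zero
      ((FaithfulSMul.algebraMap_eq_zero_iff K F).not.mpr hcx) (hDne ((L.hom σ).1 u))) ?_
    simp only [Nat.add_sub_cancel]
    linear_combination h1 - ((sgn (m + 1) (L.hom σ) [] * sgn m (L.hom σ) [] : ℤˣ) : ℤ) * h4
  refine ⟨⟨L, L.hom, L.hom_injective, ?_, L.hom_label⟩, ?_, ?_⟩
  · rintro _ ⟨σ, rfl⟩
    exact hQtilde σ
  · rintro ⟨L', φ, -, hrange, hφ⟩
    have : Normal K F := normal_arborealField hf
    have hsq : levelDet L'.fieldNode m [] ^ 2 =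
        algebraMap K F (-3 * (levelScale f m * (c - x₀)) ^ 2) := by
      apply Subtype.ext
      change ((levelDet L'.fieldNode m [] : F) : Kbar) ^ 2 = algebraMap K Kbar _
      rw [L'.coe_levelDet, (L'.branching hf).sq_levelDet hf hd hc hc', L'.node_nil]
      simp [hmap3]
    have hne0 : -3 * (levelScale f m * (c - x₀)) ^ 2 ≠ 0 :=
      mul_ne_zero (neg_ne_zero.mpr h3) (pow_ne_zero _ (mul_ne_zero hk hcx))
    have hD0 : levelDet L'.fieldNode m [] ≠ 0 := fun h => by
      rw [h, zero_pow two_ne_zero] at hsq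
      exact hne0 ((FaithfulSMul.algebraMap_eq_zero_iff K F).mp hsq.symm)
    -- Membership in `Q` says that the sign at the root is +1, so the root determinant is Galois
    -- invariant, whatever the labeling.
    obtain ⟨t, ht⟩ := isSquare_of_fixed h2 hD0 hsq fun σ => by
      have h1 := (hrange ⟨σ, rfl⟩).2
      rw [Nat.add_sub_cancel] at h1
      rw [L'.apply_levelDet hφ, h1, treeAut_nil]
      simp
    refine ⟨t / (levelScale f m * (c - x₀)), ?_⟩
    field_simp
    linear_combination ht
  · rintro ⟨t, ht⟩
    refine ⟨L, L.hom, L.hom_injective, ?_, L.hom_label⟩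
    rintro _ ⟨σ, rfl⟩
    refine ⟨hQtilde σ, ?_⟩
    obtain ⟨t', ht'⟩ : ∃ t' : K, s = algebraMap K Kbar t' := by
      have h1 : s ^ 2 = algebraMap K Kbar t ^ 2 := by
        rw [hs, ← map_pow, sq, ← ht]
        simp [hmap3]
      rcases sq_eq_sq_iff_eq_or_eq_neg.mp h1 with h | h
      · exact ⟨t, h⟩
      · exact ⟨-t, by rw [h, map_neg]⟩
    -- With s in K the root determinant lies in K, so every σ fixes it and its sign must be +1.
    have hD : levelDet L.fieldNode m [] =
        algebraMap K F (t' * (levelScale f m * (c - x₀))) := by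
      apply Subtype.ext
      change ((levelDet L.fieldNode m [] : F) : Kbar) = algebraMap K Kbar _
      rw [L.coe_levelDet, hdet, hnd0, ht']
      simp
    have h1 := L.apply_levelDet L.hom_label σ m []
    rw [treeAut_nil] at h1
    refine units_eq_of_mul_eq h2F (hDne []) ?_
    rw [Nat.add_sub_cancel, ← h1, Units.val_one, Int.cast_one, one_mul, hD]
    exact σ.commutes _
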